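/- Let $S_0,S_1\subset\mathbb{Z}_{\ge 0}$ be nonempty finite sets, and consider the polynomial parameterizations $x=P_0(t)$, $y=P_1(t)$ of plane curves, where $P_i(t)=\sum_{k\in S_i}c_{i,k}t^k\in\mathbb{C}[t]$ has fixed support $S_i$ and generic coefficients. Put $A_i=S_i\cup\{0\}$ and write in ascending order $A_0=\{a_{00}=0,a_{01},\dots,a_{0n}\}$ and $A_1=\{a_{10}=0,a_{11},\dots,a_{1m}\}$. Then there is a nonempty Zariski open (hence open and dense) subset $U$ of the coefficient space $\mathbb{C}^{S_0}\times\mathbb{C}^{S_1}$ such that, for every coefficient vector in $U$ for which the parameterization has degree $[\mathbb{C}(t):\mathbb{C}(P_0,P_1)]=1$, the following holds. The ideal of all $f\in\mathbb{C}[x,y]$ with $f(P_0(t),P_1(t))\equiv 0$ is principal. Let $\phi$ be any generator of it (the implicit equation), and let $N(\phi)\subset\mathbb{R}^2$ be its Newton polygon, i.e. the convex hull of the exponent vectors of the monomials of $\phi$. If $P_0$ or $P_1$ (or both) contains a constant term (that is, $0\in S_0\cup S_1$), then $N(\phi)$ is the triangle with vertices $(0,0),(a_{1m},0),(0,a_{0n})$.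 Otherwise, $N(\phi)$ is the quadrilateral with vertices $(a_{11},0),(a_{1m},0),(0,a_{0n}),(0,a_{01})$. (The polygon may be degenerate, as some of the listed points may coincide.) -/

import Mathlib

/-- The polynomial with exponents in `S` and coefficient vector `c`. -/
noncomputable def polyOf (S : Finset ℕ) (c : S → ℂ) : Polynomial ℂ :=
  ∑ k : S, Polynomial.monomial (k : ℕ) (c k)

/-- A property of coefficient vectors in `ℂ^ι` holds for generic coefficients if it holds on the
complement of the zero set of some nonzero polynomial, i.e. on a nonempty Zariski open subset of
the coefficient space (such a set is open and dense, also in the Euclidean topology). -/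
def HoldsGenerically {ι : Type} (p : (ι → ℂ) → Prop) : Prop :=
  ∃ F : MvPolynomial ι ℂ, F ≠ 0 ∧ ∀ c : ι → ℂ, MvPolynomial.eval c F ≠ 0 → p c

/-- The degree `[ℂ(t) : ℂ(P₀, P₁)]` of the parameterization `x = P₀(t)`, `y = P₁(t)`
(with value `0` if the extension is infinite, i.e. if both polynomials are constant). -/
noncomputable def paramDegree (P₀ P₁ : Polynomial ℂ) : ℕ :=
  Module.finrank
    (IntermediateField.adjoin ℂ
      ({algebraMap (Polynomial ℂ) (RatFunc ℂ) P₀, algebraMap (Polynomial ℂ) (RatFunc ℂ) P₁} :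
        Set (RatFunc ℂ)))
    (RatFunc ℂ)

/-- `φ` is an implicit equation of the curve `x = P₀(t)`, `y = P₁(t)`: it generates the ideal of
all polynomials in `ℂ[x, y]` (`x` is variable `0`, `y` is variable `1`) which vanish
identically after the substitution `x = P₀(t)`, `y = P₁(t)`. -/
def IsImplicitEquation (P₀ P₁ : Polynomial ℂ) (φ : MvPolynomial (Fin 2) ℂ) : Prop :=
  RingHom.ker (MvPolynomial.aeval ![P₀, P₁] : MvPolynomial (Fin 2) ℂ →ₐ[ℂ] Polynomial ℂ) =
    Ideal.span {φ}

/-- The Newton polygon: the convex hull in `ℝ²` of the exponent vectors of `φ`. -/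
def newtonPolygon (φ : MvPolynomial (Fin 2) ℂ) : Set (ℝ × ℝ) :=
  convexHull ℝ ((fun d : Fin 2 →₀ ℕ => ((d 0 : ℝ), (d 1 : ℝ))) '' (φ.support : Set (Fin 2 →₀ ℕ)))

/-- The curve `x = P₀(t)`, `y = P₁(t)` has an implicit equation, and the Newton polygon of any
such equation is the polygon whose set of vertices is `V`. -/
def ImplicitPolygonHasVertices (P₀ P₁ : Polynomial ℂ) (V : Set (ℝ × ℝ)) : Prop :=
  (∃ φ, IsImplicitEquation P₀ P₁ φ) ∧
    ∀ φ, IsImplicitEquation P₀ P₁ φ →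
      newtonPolygon φ = convexHull ℝ V ∧ (newtonPolygon φ).extremePoints ℝ = V

/-! Put `R(x, y) = Res_t(P(t) - x, Q(t) - y)` with `n = deg P`, `m = deg Q`. `R` vanishes on the
curve. If `P` is not constant, the coefficient of `y ^ n` in `R` is a nonzero constant. When `ℂ(t) =
ℂ(P, Q)`, the minimal polynomial of `Q` over `ℂ(P)` has degree `[ℂ(t) : ℂ(P)] = n`, so division by
`R` in the variable `y` leaves remainder `0` on every relation, and `R` generates the ideal
(`ker_aeval_eq_span_of_support`).

Its polygon is then found from two sides. Outer bounds: weighing the terms of the Sylvester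
determinant gives `n * i + m * j ≤ n * m` for every monomial `x ^ i * y ^ j`, and `a * b ≤ a * i + b
* j` when `t ^ a ∣ P` and `t ^ b ∣ Q`. Vertices: up to sign, `R(x, 0)` is a constant times the
product of `P(s) - x` over the roots `s` of `Q`. Its degree is `m`; its order at `x = 0` counts the
roots of `Q` at which `P` vanishes. This order is `b` when `P / t ^ a` and `Q / t ^ b` have no
common root and `0` is a root of the expected multiplicity (`coeff_axisResultant_X_pow_mul`). The
other axis is symmetric. Genericity only has to make all coefficients and one resultant nonzero. -/

open Polynomial in
/-- The resultant with respect to `t` of `P(t) - x` and `Q(t) - y`, where `x` is variable `0` and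
`y` is variable `1`. -/
noncomputable def implicitResultant (P Q : ℂ[X]) : MvPolynomial (Fin 2) ℂ :=
  Polynomial.resultant (P.map MvPolynomial.C - C (MvPolynomial.X 0))
    (Q.map MvPolynomial.C - C (MvPolynomial.X 1)) P.natDegree Q.natDegree

/-! ### Weights of the monomials of a determinant -/

section Weights

open Finset

variable {σ R ι : Type*} [CommRing R]

lemma MvPolynomial.sum_le_weight_of_mem_support_prod (w : (σ →₀ ℕ) →+ ℤ) (f : ι → MvPolynomial σ R)
    (a : ι → ℤ) (s : Finset ι) (h : ∀ j ∈ s, ∀ e ∈ (f j).support, a j ≤ w e) :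
    ∀ d ∈ (∏ j ∈ s, f j).support, ∑ j ∈ s, a j ≤ w d := by
  classical
  induction s using Finset.induction_on with
  | empty =>
    intro d hd
    have : d = 0 := by
      by_contra hne
      simp [MvPolynomial.coeff_one, Ne.symm hne] at hd
    simp [this]
  | insert i s hi ih =>
    intro d hd
    rw [prod_insert hi] at hd
    obtain ⟨d₁, h₁, d₂, h₂, rfl⟩ := Finset.mem_add.1 (MvPolynomial.support_mul _ _ hd)
    rw [sum_insert hi, map_add]
    exact add_le_add (h i (mem_insert_self _ _) _ h₁)
      (ih (fun j hj => h j (mem_insert_of_mem hj)) _ h₂)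

/-- A term of the determinant meets every row and every column once, so the bounds `a j - p i` on
its entries add up to `∑ a - ∑ p`, whatever the permutation. The row potential `p` is free, and a
good choice makes the bound sharp. -/
lemma Matrix.sum_le_weight_of_mem_support_det [Fintype ι] [DecidableEq ι] (w : (σ →₀ ℕ) →+ ℤ)
    (M : Matrix ι ι (MvPolynomial σ R)) (a p : ι → ℤ)
    (h : ∀ i j, ∀ d ∈ (M i j).support, a j ≤ w d + p i) :
    ∀ d ∈ M.det.support, ∑ j, a j ≤ w d + ∑ i, p i := by
  classical
  intro d hd
  rw [Matrix.det_apply'] at hd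
  obtain ⟨τ, -, hτ⟩ := Finset.mem_biUnion.1 (MvPolynomial.support_sum hd)
  have hτ' : d ∈ (∏ j, M (τ j) j).support := by
    rw [MvPolynomial.mem_support_iff] at hτ ⊢
    rcases Int.units_eq_one_or (Equiv.Perm.sign τ) with hs | hs <;> simpa [hs] using hτ
  have := MvPolynomial.sum_le_weight_of_mem_support_prod w (fun j => M (τ j) j)
    (fun j => a j - p (τ j)) univ
    (fun j _ e he => by have := h (τ j) j e he; linarith) d hτ'
  rw [sum_sub_distrib, Equiv.sum_comp τ p] at this
  linarith

lemma Polynomial.sum_le_weight_of_mem_support_resultant (w : (σ →₀ ℕ) →+ ℤ)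
    (f g : Polynomial (MvPolynomial σ R)) (n m : ℕ) (a b p : ℕ → ℤ)
    (hf : ∀ j < m, ∀ k ≤ n, ∀ d ∈ (f.coeff k).support, a j ≤ w d + p (j + k))
    (hg : ∀ j < n, ∀ k ≤ m, ∀ d ∈ (g.coeff k).support, b j ≤ w d + p (j + k)) :
    ∀ d ∈ (resultant f g n m).support,
      ∑ j ∈ range n, b j + ∑ j ∈ range m, a j ≤ w d + ∑ i ∈ range (n + m), p i := by
  intro d hd
  have := Matrix.sum_le_weight_of_mem_support_det w (sylvester f g n m)
    (fun j => j.addCases (fun j => b j) (fun j => a j)) (fun i => p i) ?_ d hd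
  · simpa [Fin.sum_univ_add, Finset.sum_range] using this
  · intro i j e he
    induction j using Fin.addCases with
    | left j =>
      simp only [sylvester, Matrix.of_apply, Fin.addCases_left] at he ⊢
      split_ifs at he with hij
      · have := hg j j.2 (i - j) (by have := hij.2; omega) e he
        rwa [Nat.add_sub_cancel' hij.1] at this
      · simp at he
    | right j =>
      simp only [sylvester, Matrix.of_apply, Fin.addCases_right] at he ⊢
      split_ifs at he with hij
      · have := hf j j.2 (i - j) (by have := hij.2; omega) e he
        rwa [Nat.add_sub_cancel' hij.1] at this
      · simp at he

end Weights

open Polynomial in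
lemma mem_support_coeff_map_C_sub {σ R : Type*} [CommRing R] {P : R[X]} {i : σ} {k : ℕ}
    {d : σ →₀ ℕ}
    (hd : d ∈ ((P.map MvPolynomial.C - C (MvPolynomial.X i) :
      Polynomial (MvPolynomial σ R)).coeff k).support) :
    (d = 0 ∧ P.coeff k ≠ 0) ∨ (k = 0 ∧ d = Finsupp.single i 1) := by
  classical
  rw [MvPolynomial.mem_support_iff, coeff_sub, coeff_map, coeff_C, MvPolynomial.coeff_sub,
    MvPolynomial.coeff_C] at hd
  by_cases h0 : 0 = d ∧ P.coeff k ≠ 0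
  · exact .inl ⟨h0.1.symm, h0.2⟩
  · right
    by_cases hk : k = 0
    · refine ⟨hk, ?_⟩
      by_contra hne
      rw [if_pos hk, MvPolynomial.coeff_X, if_neg (Ne.symm hne)] at hd
      split_ifs at hd with h
      · simp only [sub_zero] at hd
        exact h0 ⟨h, hd⟩
      · simp at hd
    · rw [if_neg hk] at hd
      split_ifs at hd with h
      · simp only [MvPolynomial.coeff_zero, sub_zero] at hd
        exact absurd ⟨h, hd⟩ h0
      · simp at hd

/-- Beyond `n = a` and `m = b`, each further unit adds the truncation value `a + b` to both sides.
At `n = a`, `m = b` no minimum is truncated and the sums are arithmetic progressions. -/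
lemma sum_min_add_sum_min_sub {a b n m : ℕ} (ha : a ≤ n) (hb : b ≤ m) :
    ∑ j ∈ Finset.range n, (min (j + b) (a + b) : ℤ) + ∑ j ∈ Finset.range m, (min (j + a) (a + b) : ℤ)
      = a * b + ∑ i ∈ Finset.range (n + m), (min i (a + b) : ℤ) := by
  induction n, ha using Nat.le_induction with
  | base =>
    induction m, hb using Nat.le_induction with
    | base =>
      have h (c e : ℕ) : ∑ j ∈ Finset.range c, ((j : ℤ) + e) = c * e + ∑ j ∈ Finset.range c, (j : ℤ) := by
        rw [Finset.sum_add_distrib]; simp; ring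
      have h1 : ∑ j ∈ Finset.range a, (min (j + b) (a + b) : ℤ) =
          ∑ j ∈ Finset.range a, ((j : ℤ) + b) :=
        Finset.sum_congr rfl fun j hj => min_eq_left (by have := Finset.mem_range.1 hj; omega)
      have h2 : ∑ j ∈ Finset.range b, (min (j + a) (a + b) : ℤ) =
          ∑ j ∈ Finset.range b, ((j : ℤ) + a) :=
        Finset.sum_congr rfl fun j hj => min_eq_left (by have := Finset.mem_range.1 hj; omega)
      have h3 : ∑ j ∈ Finset.range (a + b), (min j (a + b) : ℤ) =
          ∑ j ∈ Finset.range (a + b), (j : ℤ) :=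
        Finset.sum_congr rfl fun j hj => min_eq_left (by have := Finset.mem_range.1 hj; omega)
      rw [h1, h2, h3, Finset.sum_range_add, h, h]
      push_cast
      have : ∑ x ∈ Finset.range b, ((a : ℤ) + x) = a * b + ∑ j ∈ Finset.range b, (j : ℤ) := by
        rw [Finset.sum_add_distrib]; simp; ring
      rw [this]; ring
    | succ m hm ih =>
      rw [← add_assoc, Finset.sum_range_succ, Finset.sum_range_succ, ← add_assoc, ih,
        min_eq_right (by omega), min_eq_right (by push_cast; omega), add_assoc]
  | succ n hn ih =>
    rw [show n + 1 + m = (n + m) + 1 by ring, Finset.sum_range_succ, Finset.sum_range_succ,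
      add_right_comm, ih, min_eq_right (by omega), min_eq_right (by push_cast; omega), add_assoc]

/-- The additive weight `u * d 0 + v * d 1` of an exponent vector. -/
def planeWeight (u v : ℤ) : (Fin 2 →₀ ℕ) →+ ℤ where
  toFun d := u * d 0 + v * d 1
  map_zero' := by simp
  map_add' d e := by simp; ring

lemma planeWeight_apply (u v : ℤ) (d : Fin 2 →₀ ℕ) : planeWeight u v d = u * d 0 + v * d 1 := rfl

open Polynomial in
/-- A potential `p` on the rows of the Sylvester matrix bounds the weights of the monomials of the
implicit resultant. -/
lemma sum_le_planeWeight_of_mem_support_implicitResultant {P Q : ℂ[X]} (u v : ℤ) (a b p : ℕ → ℤ)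
    (hP : ∀ j < Q.natDegree, a j ≤ u + p j ∧
      ∀ k ≤ P.natDegree, P.coeff k ≠ 0 → a j ≤ p (j + k))
    (hQ : ∀ j < P.natDegree, b j ≤ v + p j ∧
      ∀ k ≤ Q.natDegree, Q.coeff k ≠ 0 → b j ≤ p (j + k))
    {d : Fin 2 →₀ ℕ} (hd : d ∈ (implicitResultant P Q).support) :
    ∑ j ∈ Finset.range P.natDegree, b j + ∑ j ∈ Finset.range Q.natDegree, a j ≤
      u * d 0 + v * d 1 + ∑ i ∈ Finset.range (P.natDegree + Q.natDegree), p i := by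
  refine Polynomial.sum_le_weight_of_mem_support_resultant (planeWeight u v) _ _ _ _ a b p ?_ ?_ d hd
  · intro j hj k hk e he
    rcases mem_support_coeff_map_C_sub he with ⟨rfl, h⟩ | ⟨rfl, rfl⟩
    · simpa using (hP j hj).2 k hk h
    · simpa [planeWeight_apply] using (hP j hj).1
  · intro j hj k hk e he
    rcases mem_support_coeff_map_C_sub he with ⟨rfl, h⟩ | ⟨rfl, rfl⟩
    · simpa using (hQ j hj).2 k hk h
    · simpa [planeWeight_apply] using (hQ j hj).1

/-! ### Half-planes containing the support of the resultant -/

section Support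

open Polynomial

variable {P Q : ℂ[X]} {d : Fin 2 →₀ ℕ}

lemma fst_le_natDegree_of_mem_support_implicitResultant
    (hd : d ∈ (implicitResultant P Q).support) : d 0 ≤ Q.natDegree := by
  have := sum_le_planeWeight_of_mem_support_implicitResultant (-1) 0 (fun _ => -1) (fun _ => 0)
    (fun _ => 0) (by simp) (by simp) hd
  simp at this
  omega

lemma snd_le_natDegree_of_mem_support_implicitResultant
    (hd : d ∈ (implicitResultant P Q).support) : d 1 ≤ P.natDegree := by
  have := sum_le_planeWeight_of_mem_support_implicitResultant 0 (-1) (fun _ => 0) (fun _ => -1)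
    (fun _ => 0) (by simp) (by simp) hd
  simp at this
  omega

lemma weight_le_of_mem_support_implicitResultant (hd : d ∈ (implicitResultant P Q).support) :
    P.natDegree * d 0 + Q.natDegree * d 1 ≤ P.natDegree * Q.natDegree := by
  have := sum_le_planeWeight_of_mem_support_implicitResultant (-P.natDegree) (-Q.natDegree)
    (fun j => -P.natDegree - j) (fun j => -Q.natDegree - j) (fun i => -i)
    (fun j _ => ⟨by linarith, fun k hk _ => by push_cast; omega⟩)
    (fun j _ => ⟨by linarith, fun k hk _ => by push_cast; omega⟩) hd
  rw [Finset.sum_range_add] at this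
  simp only [Finset.sum_sub_distrib, Finset.sum_neg_distrib, Finset.sum_const, Finset.card_range,
    Nat.cast_add, Finset.sum_add_distrib, nsmul_eq_mul] at this
  zify
  linarith

/-- The truncation of the potential at `a + b` is essential: `p i = i` is also admissible, but only
gives the bound `a * b - (n - a) * (m - b)`, where `n`, `m` are the degrees. -/
lemma le_weight_of_mem_support_implicitResultant {a b : ℕ} (ha : a ≤ P.natDegree)
    (hb : b ≤ Q.natDegree) (hP : X ^ a ∣ P) (hQ : X ^ b ∣ Q)
    (hd : d ∈ (implicitResultant P Q).support) : a * b ≤ a * d 0 + b * d 1 := by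
  rw [X_pow_dvd_iff] at hP hQ
  have := sum_le_planeWeight_of_mem_support_implicitResultant a b
    (fun j => min (j + a) (a + b)) (fun j => min (j + b) (a + b)) (fun i => min i (a + b))
    (fun j _ => ⟨by omega, fun k _ hk => by
      have : a ≤ k := not_lt.1 fun h => hk (hP k h)
      push_cast; omega⟩)
    (fun j _ => ⟨by omega, fun k _ hk => by
      have : b ≤ k := not_lt.1 fun h => hk (hQ k h)
      push_cast; omega⟩) hd
  rw [sum_min_add_sum_min_sub ha hb] at this
  zify
  linarith

end Support
-- Coefficients of the resultant on the coordinate axes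
section Coefficients

open Polynomial

variable {P Q : ℂ[X]}

lemma map_implicitResultant {A : Type*} [CommRing A] [Algebra ℂ A]
    (f : MvPolynomial (Fin 2) ℂ →ₐ[ℂ] A) (P Q : ℂ[X]) :
    f (implicitResultant P Q) =
      resultant (P.map (algebraMap ℂ A) - C (f (MvPolynomial.X 0)))
        (Q.map (algebraMap ℂ A) - C (f (MvPolynomial.X 1))) P.natDegree Q.natDegree := by
  have h : (f : MvPolynomial (Fin 2) ℂ →+* A).comp MvPolynomial.C = algebraMap ℂ A :=
    f.comp_algebraMap
  have := resultant_map_map (P.map MvPolynomial.C - C (MvPolynomial.X 0))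
    (Q.map MvPolynomial.C - C (MvPolynomial.X 1)) P.natDegree Q.natDegree
    (f : MvPolynomial (Fin 2) ℂ →+* A)
  rw [Polynomial.map_sub, Polynomial.map_sub, Polynomial.map_map, Polynomial.map_map, h,
    map_C, map_C] at this
  exact this.symm

lemma natDegree_map_sub_C_le {A : Type*} [CommRing A] [Algebra ℂ A] (P : ℂ[X]) (r : A) :
    (P.map (algebraMap ℂ A) - C r).natDegree ≤ P.natDegree :=
  natDegree_sub_C.trans_le natDegree_map_le

/-- The resultant lies in the ideal generated by `P(t) - x` and `Q(t) - y`. After `x = P(s)`, `y =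
Q(s)`, both generators vanish at `t = s`. -/
lemma aeval_implicitResultant (h : P.natDegree ≠ 0 ∨ Q.natDegree ≠ 0) :
    MvPolynomial.aeval ![P, Q] (implicitResultant P Q) = 0 := by
  rw [map_implicitResultant, MvPolynomial.aeval_X, MvPolynomial.aeval_X]
  obtain ⟨p, q, -, -, hpq⟩ := exists_mul_add_mul_eq_C_resultant
    (P.map (algebraMap ℂ ℂ[X]) - C (![P, Q] 0))
    (Q.map (algebraMap ℂ ℂ[X]) - C (![P, Q] 1))
    (natDegree_map_sub_C_le P _) (natDegree_map_sub_C_le Q _) h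
  have := congrArg (eval X) hpq
  have hX (F : ℂ[X]) : eval X (F.map (algebraMap ℂ ℂ[X])) = F := by
    rw [eval_map_algebraMap, aeval_X_left_apply]
  rw [eval_C, eval_add, eval_mul, eval_mul, eval_sub, eval_sub, eval_C, eval_C, hX, hX] at this
  rw [← this]
  simp

lemma coeff_aeval_ite {σ R : Type*} [Fintype σ] [DecidableEq σ] [CommRing R] (i : σ)
    (F : MvPolynomial σ R) (k : ℕ) :
    (MvPolynomial.aeval (fun j => if j = i then (X : R[X]) else 0) F).coeff k =
      F.coeff (Finsupp.single i k) := by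
  induction F using MvPolynomial.induction_on' with
  | add p q hp hq => simp [hp, hq]
  | monomial d c =>
    rw [MvPolynomial.aeval_monomial, MvPolynomial.coeff_monomial,
      Finsupp.prod_fintype _ _ (fun _ => pow_zero _), algebraMap_eq, coeff_C_mul]
    by_cases h : ∃ j, j ≠ i ∧ d j ≠ 0
    · obtain ⟨j, hj, hd⟩ := h
      rw [Finset.prod_eq_zero (Finset.mem_univ j) (by simp [hj, hd]), if_neg]
      · simp
      · rintro rfl
        simp [Ne.symm hj] at hd
    · push Not at h
      have hd : d = Finsupp.single i (d i) := by
        ext j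
        by_cases hj : j = i
        · simp [hj]
        · simp [h j hj, Ne.symm hj]
      rw [Finset.prod_eq_single i (fun j _ hj => by simp [h j hj]) (by simp), if_pos rfl,
        coeff_X_pow]
      by_cases hk : d i = k
      · rw [if_pos hk.symm, if_pos (hk ▸ hd), mul_one]
      · rw [if_neg (Ne.symm hk), if_neg, mul_zero]
        rintro rfl
        simp at hk

/-- The resultant with respect to `t` of `Q(t)` and `P(t) - x`. -/
noncomputable def axisResultant (P Q : ℂ[X]) : ℂ[X] :=
  resultant (Q.map C) (P.map C - C X) Q.natDegree P.natDegree

lemma coeff_single_zero_implicitResultant (k : ℕ) :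
    (implicitResultant P Q).coeff (Finsupp.single 0 k) ≠ 0 ↔ (axisResultant P Q).coeff k ≠ 0 := by
  rw [← coeff_aeval_ite, map_implicitResultant, resultant_comm, MvPolynomial.aeval_X,
    MvPolynomial.aeval_X, if_pos rfl, if_neg (by decide), C_0, sub_zero]
  rcases neg_one_pow_eq_or ℂ[X] (P.natDegree * Q.natDegree) with h | h <;>
    simp [h, axisResultant, algebraMap_eq]

lemma coeff_single_one_implicitResultant (k : ℕ) :
    (implicitResultant P Q).coeff (Finsupp.single 1 k) ≠ 0 ↔ (axisResultant Q P).coeff k ≠ 0 := by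
  rw [← coeff_aeval_ite, map_implicitResultant, MvPolynomial.aeval_X,
    MvPolynomial.aeval_X, if_pos rfl, if_neg (by decide), C_0, sub_zero]
  rfl

/-- The resultant is a power of the leading coefficient of `Q` times the product of `P(s) - x` over
the roots `s` of `Q`, hence has degree exactly `deg Q` in `x`. -/
lemma coeff_natDegree_axisResultant (hQ : Q ≠ 0) : (axisResultant P Q).coeff Q.natDegree ≠ 0 := by
  have hs := IsAlgClosed.splits Q
  have hinj : Function.Injective (C : ℂ →+* ℂ[X]) := C_injective
  have hdeg : (Q.map C).natDegree = Q.natDegree := natDegree_map_eq_of_injective hinj Q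
  have h := resultant_eq_prod_eval (Q.map C) (P.map C - C X) P.natDegree
    (natDegree_map_sub_C_le P X) (hs.map C)
  rw [hdeg, leadingCoeff_map_of_injective hinj, hs.roots_map_of_injective hinj,
    Multiset.map_map] at h
  have he : Q.roots.map ((fun r => eval r (P.map C - C X)) ∘ C) =
      (Q.roots.map P.eval).map (fun a => - (X - C a)) := by
    rw [Multiset.map_map]
    refine Multiset.map_congr rfl fun s _ => ?_
    simp [eval_map, eval₂_at_apply]
  have he' : ((Q.roots.map P.eval).map (fun a => - (X - C a))).prod =
      (-1) ^ Q.natDegree * ((Q.roots.map P.eval).map (fun a => X - C a)).prod := by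
    have := Multiset.prod_map_neg ((Q.roots.map P.eval).map (fun a => X - C a))
    rw [Multiset.map_map, Multiset.card_map, Multiset.card_map,
      ← hs.natDegree_eq_card_roots] at this
    exact this
  rw [axisResultant, h, he, he', ← C_pow, coeff_C_mul]
  refine mul_ne_zero (pow_ne_zero _ (by simpa using hQ)) ?_
  have hm : ((Q.roots.map P.eval).map (fun a => X - C a)).prod.coeff Q.natDegree = 1 := by
    have h1 := monic_multiset_prod_of_monic (Q.roots.map P.eval) (fun a => X - C a)
      (fun a _ => monic_X_sub_C a)
    have h2 := natDegree_multiset_prod_X_sub_C_eq_card (Q.roots.map P.eval)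
    rw [Multiset.card_map, ← hs.natDegree_eq_card_roots] at h2
    rw [← h2]; exact h1
  rw [show ((-1 : ℂ[X]) ^ Q.natDegree) = C ((-1) ^ Q.natDegree) by simp, coeff_C_mul, hm]
  simp

/-- The coefficient of `x ^ b` in `Res(t ^ b * Q', t ^ a * P' - x)` does not vanish. -/
lemma coeff_axisResultant_X_pow_mul {P' Q' : ℂ[X]} {a b : ℕ} (hP' : P' ≠ 0) (hQ' : Q' ≠ 0)
    (hres : resultant P' Q' ≠ 0) (hb : b ≠ 0 → a ≠ 0) (ha : a ≠ 0 → Q'.coeff 0 ≠ 0) :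
    (axisResultant (X ^ a * P') (X ^ b * Q')).coeff b ≠ 0 := by
  have hdeg : (X ^ b * Q').natDegree = b + Q'.natDegree := by
    rw [natDegree_mul (by simp) hQ', natDegree_X_pow]
  have hPdeg : (X ^ a * P').natDegree = a + P'.natDegree := by
    rw [natDegree_mul (by simp) hP', natDegree_X_pow]
  set G : ℂ[X][X] := (X ^ a * P').map C - C X with hG
  have hGdeg : G.natDegree ≤ (X ^ a * P').natDegree := natDegree_map_sub_C_le _ _
  -- The factor `t ^ b` splits off as the value of `P - x` at `t = 0`, to the power `b`. For `b ≠ 0`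
  -- that value is `-x`, which accounts for the whole power `x ^ b`.
  have hmul : axisResultant (X ^ a * P') (X ^ b * Q') =
      (G.coeff 0) ^ b * resultant (Q'.map C) G Q'.natDegree (X ^ a * P').natDegree := by
    have := resultant_mul_left (X ^ b) (Q'.map C) G _ hGdeg
    rw [natDegree_X_pow, natDegree_map_eq_of_injective C_injective,
      resultant_X_pow_left _ _ _ hGdeg] at this
    rw [← this, axisResultant, hdeg]
    rw [Polynomial.map_mul, Polynomial.map_pow, map_X]
  -- At `x = 0` the cofactor is `Res(Q', t ^ a * P')`, up to sign `Q'(0) ^ a * Res(P', Q')`.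
  have h0 : (resultant (Q'.map C) G Q'.natDegree (X ^ a * P').natDegree).coeff 0 ≠ 0 := by
    have := resultant_map_map (Q'.map C) G Q'.natDegree (X ^ a * P').natDegree (evalRingHom 0)
    rw [coe_evalRingHom, ← coeff_zero_eq_eval_zero] at this
    have hid : (evalRingHom (0 : ℂ)).comp C = RingHom.id ℂ := by ext; simp
    rw [← this]
    rw [hG, Polynomial.map_sub, Polynomial.map_map, Polynomial.map_map, hid, Polynomial.map_id,
      Polynomial.map_id, map_C, coe_evalRingHom, eval_X, C_0, sub_zero, hPdeg]
    have h2 := resultant_mul_right Q' (X ^ a) P' Q'.natDegree le_rfl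
    rw [natDegree_X_pow, resultant_X_pow_right _ _ _ le_rfl] at h2
    rw [h2, resultant_comm Q' P']
    refine mul_ne_zero (mul_ne_zero (by simp) ?_) (mul_ne_zero (by simp) hres)
    by_cases h : a = 0
    · simp [h]
    · exact pow_ne_zero _ (ha h)
  rw [hmul]
  by_cases hb0 : b = 0
  · simpa [hb0] using h0
  · have : G.coeff 0 = - X := by
      simp [hG, (hb hb0).symm]
    rw [this, neg_pow, mul_assoc, show ((-1 : ℂ[X]) ^ b) = C ((-1) ^ b) by simp, coeff_C_mul,
      coeff_X_pow_mul', if_pos le_rfl, Nat.sub_self]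
    exact mul_ne_zero (by simp) h0

end Coefficients

/-! ### The resultant generates the ideal of relations -/

section Kernel

open Polynomial IntermediateField

/-- If `ℂ(t) = ℂ(P, Q)`, then `Q` satisfies no nontrivial equation of degree less than `deg P`
with coefficients in `ℂ[P]`. -/
lemma eq_zero_of_eval₂_aeval_eq_zero {P Q : ℂ[X]} (hP : P.natDegree ≠ 0)
    (h : adjoin ℂ ({algebraMap ℂ[X] (RatFunc ℂ) P, algebraMap ℂ[X] (RatFunc ℂ) Q} :
      Set (RatFunc ℂ)) = ⊤)
    {r : ℂ[X][X]} (hr : r.natDegree < P.natDegree) (h0 : eval₂ (aeval P : ℂ[X] →ₐ[ℂ] ℂ[X]) Q r = 0) :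
    r = 0 := by
  set p : RatFunc ℂ := algebraMap ℂ[X] (RatFunc ℂ) P
  set q : RatFunc ℂ := algebraMap ℂ[X] (RatFunc ℂ) Q
  have hpC : ¬ ∃ c, p = RatFunc.C c := by
    rintro ⟨c, hc⟩
    have : P = C c := RatFunc.algebraMap_injective ℂ (by rw [RatFunc.algebraMap_C]; exact hc)
    exact hP (by simp [this])
  have hfin : Module.finrank ℂ⟮p⟯ (RatFunc ℂ) = P.natDegree := by
    rw [RatFunc.finrank_eq_max_natDegree]; simp [p]
  have htop : ℂ⟮p⟯⟮q⟯ = ⊤ := by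
    rw [← restrictScalars_eq_top_iff (K := ℂ), adjoin_simple_adjoin_simple]; exact h
  have : FiniteDimensional ℂ⟮p⟯ (RatFunc ℂ) := .of_finrank_pos (by omega)
  -- Since `q` generates `ℂ(t)` over `ℂ(p)`, its degree is the full `[ℂ(t) : ℂ(p)] = deg P`.
  have hmin : (minpoly ℂ⟮p⟯ q).natDegree = P.natDegree := by
    rw [← adjoin.finrank (.of_finite ℂ⟮p⟯ q), htop, finrank_top', hfin]
  let φ : ℂ[X] →ₐ[ℂ] ℂ⟮p⟯ := aeval (AdjoinSimple.gen ℂ p)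
  have hφ : Function.Injective φ := by
    have := RatFunc.transcendental_of_ne_C p hpC
    have h2 : Transcendental ℂ (AdjoinSimple.gen ℂ p) := by
      intro hh
      exact this (by simpa using hh.algebraMap (A := RatFunc ℂ))
    exact transcendental_iff_injective.1 h2
  have hzero : aeval q (r.map (φ : ℂ[X] →+* ℂ⟮p⟯)) = 0 := by
    have h1 := congrArg (algebraMap ℂ[X] (RatFunc ℂ)) h0
    rw [hom_eval₂, map_zero] at h1
    rw [aeval_def, eval₂_map]
    convert! h1 using 2
    ext
    · simp [φ]
    · simp [φ, p]
  by_contra hne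
  have hne' : r.map (φ : ℂ[X] →+* ℂ⟮p⟯) ≠ 0 := (Polynomial.map_ne_zero_iff hφ).2 hne
  have := natDegree_le_natDegree (minpoly.degree_le_of_ne_zero ℂ⟮p⟯ q hne' hzero)
  rw [hmin, natDegree_map_eq_of_injective (f := (φ : ℂ[X] →+* ℂ⟮p⟯)) hφ] at this
  omega

/-- Over `ℂ(t) = ℂ(p i, p j)`, a relation between `p i` and `p j` whose degree in the variable `j`
is `deg (p i)`, with constant leading coefficient, generates all relations. -/
lemma ker_aeval_eq_span_of_support {p : Fin 2 → ℂ[X]} {i j : Fin 2} (hij : i ≠ j)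
    (hp : (p i).natDegree ≠ 0)
    (h : adjoin ℂ ({algebraMap ℂ[X] (RatFunc ℂ) (p i), algebraMap ℂ[X] (RatFunc ℂ) (p j)} :
      Set (RatFunc ℂ)) = ⊤)
    {φ : MvPolynomial (Fin 2) ℂ} (h0 : MvPolynomial.aeval p φ = 0)
    (hle : ∀ d ∈ φ.support, d j ≤ (p i).natDegree ∧ (d j = (p i).natDegree → d i = 0))
    (hc : φ.coeff (Finsupp.single j (p i).natDegree) ≠ 0) :
    RingHom.ker (MvPolynomial.aeval p : MvPolynomial (Fin 2) ℂ →ₐ[ℂ] ℂ[X]) = Ideal.span {φ} := by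
  set n := (p i).natDegree
  set c := φ.coeff (Finsupp.single j n)
  have hfin (k : Fin 2) : k = i ∨ k = j := by omega
  -- `β` reads a polynomial as one in the variable `j` over `ℂ[x_i]`, `α` undoes this, and `γ` is
  -- the substitution of `p i` and `p j`.
  let β : MvPolynomial (Fin 2) ℂ →ₐ[ℂ] ℂ[X][X] :=
    MvPolynomial.aeval fun k => if k = j then X else C X
  let α : ℂ[X][X] →+* MvPolynomial (Fin 2) ℂ :=
    eval₂RingHom (aeval (MvPolynomial.X i) : ℂ[X] →ₐ[ℂ] MvPolynomial (Fin 2) ℂ) (MvPolynomial.X j)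
  let γ : ℂ[X][X] →+* ℂ[X] := eval₂RingHom (aeval (p i) : ℂ[X] →ₐ[ℂ] ℂ[X]) (p j)
  have hαβ (F) : α (β F) = F := by
    have : α.comp (β : MvPolynomial (Fin 2) ℂ →+* ℂ[X][X]) = RingHom.id _ := by
      apply MvPolynomial.ringHom_ext
      · intro r
        simp [α, β, Polynomial.algebraMap_apply, MvPolynomial.algebraMap_eq]
      · intro k
        rcases hfin k with rfl | rfl <;> simp [α, β, hij]
    exact congrArg (fun f => f F) this
  have hγβ (F) : γ (β F) = MvPolynomial.aeval p F := by
    have : γ.comp (β : MvPolynomial (Fin 2) ℂ →+* ℂ[X][X]) =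
        (MvPolynomial.aeval p : MvPolynomial (Fin 2) ℂ →ₐ[ℂ] ℂ[X]) := by
      apply MvPolynomial.ringHom_ext
      · intro r
        simp [γ, β, Polynomial.algebraMap_apply]
      · intro k
        rcases hfin k with rfl | rfl <;> simp [γ, β, hij]
    exact congrArg (fun f => f F) this
  have hmon : ∀ d : Fin 2 →₀ ℕ, β (MvPolynomial.monomial d (φ.coeff d)) =
      C (C (φ.coeff d) * X ^ d i) * X ^ d j := by
    intro d
    rw [MvPolynomial.aeval_monomial, Finsupp.prod_fintype _ _ (fun _ => pow_zero _)]
    have : (Finset.univ : Finset (Fin 2)) = {i, j} := by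
      ext k; simpa using hfin k
    rw [this, Finset.prod_pair hij]
    simp [hij, Polynomial.algebraMap_apply, mul_assoc]
  have hsum : β φ = ∑ d ∈ φ.support, C (C (φ.coeff d) * X ^ d i) * X ^ d j := by
    conv_lhs => rw [φ.as_sum]
    rw [map_sum]
    exact Finset.sum_congr rfl fun d _ => hmon d
  have hdeg : (β φ).natDegree ≤ n := by
    rw [hsum]
    exact natDegree_sum_le_of_forall_le _ _ fun d hd =>
      (natDegree_C_mul_X_pow_le _ _).trans (hle d hd).1
  have hcoeff : (β φ).coeff n = C c := by
    rw [hsum, finsetSum_coeff, Finset.sum_eq_single (Finsupp.single j n)]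
    · simp [hij.symm, c]
    · intro d hd hne
      rw [coeff_C_mul, coeff_X_pow, if_neg, mul_zero]
      intro hn
      apply hne
      ext k
      rcases hfin k with rfl | rfl
      · simpa [hij.symm] using (hle d hd).2 hn.symm
      · simp [hn]
    · intro hn
      exact absurd (MvPolynomial.mem_support_iff.2 hc) hn
  have hmonic : (C (C c⁻¹) * β φ).Monic := by
    refine monic_of_natDegree_le_of_coeff_eq_one n ((natDegree_C_mul_le _ _).trans hdeg) ?_
    rw [coeff_C_mul, hcoeff, ← C_mul, inv_mul_cancel₀ hc, C_1]
  have hmdeg : (C (C c⁻¹) * β φ).natDegree = n := by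
    refine le_antisymm ((natDegree_C_mul_le _ _).trans hdeg) (le_natDegree_of_ne_zero ?_)
    rw [coeff_C_mul, hcoeff, ← C_mul, inv_mul_cancel₀ hc, C_1]
    exact one_ne_zero
  apply le_antisymm
  · intro ψ hψ
    rw [RingHom.mem_ker] at hψ
    have hψ' : γ (β ψ) = 0 := (hγβ ψ).trans hψ
    have hdiv := modByMonic_add_div (β ψ) (C (C c⁻¹) * β φ)
    -- The remainder is again a relation, of degree less than `deg (p i)` in the variable `j`, so it
    -- vanishes.
    have hrem : β ψ %ₘ (C (C c⁻¹) * β φ) = 0 := by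
      refine eq_zero_of_eval₂_aeval_eq_zero hp h (Q := p j) ?_ ?_
      · refine lt_of_lt_of_eq ?_ hmdeg
        refine natDegree_modByMonic_lt _ hmonic fun h1 => hp ?_
        rw [← hmdeg, h1, natDegree_one]
      · have := congrArg γ hdiv
        rw [map_add, map_mul, map_mul, hγβ φ, h0, hψ'] at this
        simpa [γ] using this
    rw [hrem, zero_add] at hdiv
    rw [Ideal.mem_span_singleton, ← hαβ ψ, ← hdiv, map_mul, map_mul, hαβ φ]
    exact (Dvd.intro_left _ rfl).mul_right _
  · rw [Ideal.span_singleton_le_iff_mem, RingHom.mem_ker]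
    exact h0

lemma adjoin_eq_top_of_paramDegree_eq_one {P Q : ℂ[X]} (h : paramDegree P Q = 1) :
    adjoin ℂ ({algebraMap ℂ[X] (RatFunc ℂ) P, algebraMap ℂ[X] (RatFunc ℂ) Q} :
      Set (RatFunc ℂ)) = ⊤ :=
  finrank_eq_one_iff_eq_top.1 h

lemma natDegree_ne_zero_of_paramDegree_eq_one {P Q : ℂ[X]} (h : paramDegree P Q = 1) :
    P.natDegree ≠ 0 ∨ Q.natDegree ≠ 0 := by
  by_contra! hh
  obtain ⟨p, hp⟩ := natDegree_eq_zero.1 hh.1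
  obtain ⟨q, hq⟩ := natDegree_eq_zero.1 hh.2
  have h1 := adjoin_eq_top_of_paramDegree_eq_one h
  have h2 : (⊤ : IntermediateField ℂ (RatFunc ℂ)) ≤ ⊥ := by
    rw [← h1, adjoin_le_iff]
    rintro x (rfl | rfl)
    · rw [← hp]
      exact ⟨p, by simp⟩
    · rw [← hq]
      exact ⟨q, by simp⟩
  obtain ⟨c, hc⟩ := mem_bot.1 (h2 (mem_top (x := (RatFunc.X : RatFunc ℂ))))
  have : (C c : ℂ[X]) = X := RatFunc.algebraMap_injective ℂ (by
    rw [RatFunc.algebraMap_C, RatFunc.algebraMap_X]; exact hc)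
  simpa using congrArg natDegree this

/-- For a parameterization of degree one, the implicit resultant is an implicit equation. -/
lemma isImplicitEquation_implicitResultant {P Q : ℂ[X]} (hP : P ≠ 0) (hQ : Q ≠ 0)
    (h : paramDegree P Q = 1) : IsImplicitEquation P Q (implicitResultant P Q) := by
  have h0 := natDegree_ne_zero_of_paramDegree_eq_one h
  have htop := adjoin_eq_top_of_paramDegree_eq_one h
  by_cases hn : P.natDegree = 0
  -- For constant `P` the division is done in `x` instead, over `ℂ(Q) = ℂ(t)`.
  · have hm : Q.natDegree ≠ 0 := h0.resolve_left (not_not.2 hn)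
    refine ker_aeval_eq_span_of_support (p := ![P, Q]) (i := 1) (j := 0) (by decide) hm
      (by simpa [Set.pair_comm] using htop) (aeval_implicitResultant h0) (fun d hd => ?_) ?_
    · refine ⟨fst_le_natDegree_of_mem_support_implicitResultant hd, fun _ => ?_⟩
      have := snd_le_natDegree_of_mem_support_implicitResultant hd
      omega
    · exact (coeff_single_zero_implicitResultant _).2 (coeff_natDegree_axisResultant hQ)
  · refine ker_aeval_eq_span_of_support (p := ![P, Q]) (i := 0) (j := 1) (by decide) hn
      htop (aeval_implicitResultant h0) (fun d hd => ?_) ?_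
    · refine ⟨snd_le_natDegree_of_mem_support_implicitResultant hd, fun hd1 => ?_⟩
      have := weight_le_of_mem_support_implicitResultant hd
      have hd1' : d 1 = P.natDegree := hd1
      rw [hd1', mul_comm Q.natDegree] at this
      have h3 : P.natDegree * d 0 = 0 := by omega
      exact (mul_eq_zero.1 h3).resolve_left hn
    · exact (coeff_single_one_implicitResultant _).2 (coeff_natDegree_axisResultant hP)

/-- Two generators differ by a unit, that is, by a nonzero constant. -/
lemma IsImplicitEquation.support_eq {P Q : ℂ[X]} {φ ψ : MvPolynomial (Fin 2) ℂ}
    (hφ : IsImplicitEquation P Q φ) (hψ : IsImplicitEquation P Q ψ) : φ.support = ψ.support := by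
  have : Associated φ ψ := Ideal.span_singleton_eq_span_singleton.1 (hφ.symm.trans hψ)
  obtain ⟨u, hu⟩ := this
  obtain ⟨c, hc, hcu⟩ := MvPolynomial.isUnit_iff_eq_C_of_isReduced.1 u.isUnit
  rw [← hu, hcu]
  ext d
  simp [mul_comm φ, hc.ne_zero]

end Kernel
-- Triangles and quadrilaterals in the plane
section ConvexGeometry

/-- If every point of `V` is the unique maximum on `V` of some linear functional, then the extreme
points of the convex hull of `V` are the points of `V`. -/
lemma extremePoints_convexHull_eq_of_exists_lt {E : Type*} [AddCommGroup E] [Module ℝ E]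
    {V : Set E} (h : ∀ v ∈ V, ∃ l : E →ₗ[ℝ] ℝ, ∀ u ∈ V, u ≠ v → l u < l v) :
    (convexHull ℝ V).extremePoints ℝ = V := by
  refine Set.Subset.antisymm extremePoints_convexHull_subset fun v hv => ?_
  obtain ⟨l, hl⟩ := h v hv
  -- An open half-plane together with one point of its boundary is convex.
  have hconv : Convex ℝ {u | u = v ∨ l u < l v} := by
    intro x hx y hy s t hs ht hst
    by_cases hxy : x = v ∧ y = v
    · left
      rw [hxy.1, hxy.2, ← add_smul, hst, one_smul]
    · rcases hs.eq_or_lt with rfl | hs'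
      · simpa [show t = 1 by linarith] using hy
      rcases ht.eq_or_lt with rfl | ht'
      · simpa [show s = 1 by linarith] using hx
      right
      have hx' : l x ≤ l v := hx.elim (fun h => h ▸ le_rfl) le_of_lt
      have hy' : l y ≤ l v := hy.elim (fun h => h ▸ le_rfl) le_of_lt
      have hlt : l x < l v ∨ l y < l v := by
        by_contra! hcon
        exact hxy ⟨hx.resolve_right hcon.1.not_gt, hy.resolve_right hcon.2.not_gt⟩
      rw [map_add, map_smul, map_smul, smul_eq_mul, smul_eq_mul]
      have hsum : s * l v + t * l v = l v := by rw [← add_mul, hst, one_mul]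
      rcases hlt with h1 | h1 <;> nlinarith
  have hsub : convexHull ℝ V ⊆ {u | u = v ∨ l u < l v} :=
    convexHull_min (fun u hu => (eq_or_ne u v).imp_right (hl u hu)) hconv
  refine mem_extremePoints.2 ⟨subset_convexHull ℝ V hv, fun x hx y hy hxy => ?_⟩
  obtain ⟨s, t, hs, ht, hst, hv'⟩ := hxy
  have hlv : s * l x + t * l y = l v := by rw [← hv']; simp
  have hsum : s * l v + t * l v = l v := by rw [← add_mul, hst, one_mul]
  have hx' : l x ≤ l v := (hsub hx).elim (fun h => h ▸ le_rfl) le_of_lt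
  have hy' : l y ≤ l v := (hsub hy).elim (fun h => h ▸ le_rfl) le_of_lt
  exact ⟨(hsub hx).resolve_right fun h1 => by nlinarith,
    (hsub hy).resolve_right fun h1 => by nlinarith⟩

/-- The linear functional `p * x + q * y` on the plane. -/
noncomputable def planeFunctional (p q : ℝ) : ℝ × ℝ →ₗ[ℝ] ℝ :=
  p • LinearMap.fst ℝ ℝ ℝ + q • LinearMap.snd ℝ ℝ ℝ

lemma planeFunctional_apply (p q x y : ℝ) : planeFunctional p q (x, y) = p * x + q * y := rfl

lemma extremePoints_triangle {m n : ℝ} (hm : 0 ≤ m) (hn : 0 ≤ n) :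
    (convexHull ℝ {((0 : ℝ), (0 : ℝ)), (m, (0 : ℝ)), ((0 : ℝ), n)}).extremePoints ℝ =
      {((0 : ℝ), (0 : ℝ)), (m, (0 : ℝ)), ((0 : ℝ), n)} := by
  refine extremePoints_convexHull_eq_of_exists_lt fun v hv => ?_
  by_cases hv0 : v = (0, 0)
  · subst hv0
    refine ⟨planeFunctional (-1) (-1), ?_⟩
    rintro u (rfl | rfl | rfl) hne <;>
      simp only [planeFunctional_apply, ne_eq, Prod.mk.injEq, true_and, and_true] at hne ⊢
    · simp at hne
    · have := lt_of_le_of_ne hm (Ne.symm hne); linarith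
    · have := lt_of_le_of_ne hn (Ne.symm hne); linarith
  · rcases hv with rfl | rfl | rfl
    · exact absurd rfl hv0
    · have hm' : 0 < m := lt_of_le_of_ne hm fun h => hv0 (by rw [← h])
      refine ⟨planeFunctional 1 0, ?_⟩
      rintro u (rfl | rfl | rfl) hne <;> simp only [planeFunctional_apply]
      · linarith
      · exact absurd rfl hne
      · linarith
    · have hn' : 0 < n := lt_of_le_of_ne hn fun h => hv0 (by rw [← h])
      refine ⟨planeFunctional 0 1, ?_⟩
      rintro u (rfl | rfl | rfl) hne <;> simp only [planeFunctional_apply]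
      · linarith
      · linarith
      · exact absurd rfl hne

lemma mem_convexHull_triangle {m n x y : ℝ} (hm : 0 ≤ m) (hn : 0 ≤ n) (hx : 0 ≤ x) (hy : 0 ≤ y)
    (hm0 : m = 0 → x = 0) (hn0 : n = 0 → y = 0) (h : x / m + y / n ≤ 1) :
    (x, y) ∈ convexHull ℝ {((0 : ℝ), (0 : ℝ)), (m, (0 : ℝ)), ((0 : ℝ), n)} := by
  set A := convexHull ℝ {((0 : ℝ), (0 : ℝ)), (m, (0 : ℝ)), ((0 : ℝ), n)}
  have h0 : ((0 : ℝ), (0 : ℝ)) ∈ A := subset_convexHull ℝ _ (by simp)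
  have h1 : (m, (0 : ℝ)) ∈ A := subset_convexHull ℝ _ (by simp)
  have h2 : ((0 : ℝ), n) ∈ A := subset_convexHull ℝ _ (by simp)
  have hxm : x / m * m = x := by
    by_cases hm' : m = 0
    · simp [hm', hm0 hm']
    · field_simp
  have hyn : y / n * n = y := by
    by_cases hn' : n = 0
    · simp [hn', hn0 hn']
    · field_simp
  -- Barycentric coordinates; for `m = 0` or `n = 0` the convention `x / 0 = 0` gives the repeated
  -- vertex weight zero.
  have := (convex_convexHull ℝ _).sum_mem (t := Finset.univ) (s := A)
    (w := ![1 - x / m - y / n, x / m, y / n]) (z := ![(0, 0), (m, 0), (0, n)])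
    (by
      intro i _
      fin_cases i
      · simp only [Fin.zero_eta, Matrix.cons_val_zero]; linarith
      · simpa using div_nonneg hx hm
      · simpa using div_nonneg hy hn)
    (by rw [Fin.sum_univ_three]; simp; ring)
    (by intro i _; fin_cases i <;> assumption)
  simpa [Fin.sum_univ_three, hxm, hyn] using this

variable {a b m n : ℝ}

lemma extremePoints_quadrilateral (ha : 0 < a) (hb : 0 < b) (han : a ≤ n) (hbm : b ≤ m) :
    (convexHull ℝ {(b, (0 : ℝ)), (m, (0 : ℝ)), ((0 : ℝ), n), ((0 : ℝ), a)}).extremePoints ℝ =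
      {(b, (0 : ℝ)), (m, (0 : ℝ)), ((0 : ℝ), n), ((0 : ℝ), a)} := by
  have hab := mul_pos ha hb
  refine extremePoints_convexHull_eq_of_exists_lt fun v hv => ?_
  rcases hv with rfl | rfl | rfl | rfl
  -- The functional `-(a * x + b * y)` is constant on the lower edge; doubling its second
  -- coefficient tilts it so that `(b, 0)` wins over `(0, a)`.
  · refine ⟨planeFunctional (-a) (-(2 * b)), ?_⟩
    rintro u (rfl | rfl | rfl | rfl) hne <;>
      simp only [planeFunctional_apply, ne_eq, Prod.mk.injEq, and_true] at hne ⊢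
    · simp at hne
    · have := lt_of_le_of_ne hbm (Ne.symm hne); nlinarith
    · nlinarith
    · nlinarith
  · refine ⟨planeFunctional 1 0, ?_⟩
    rintro u (rfl | rfl | rfl | rfl) hne <;>
      simp only [planeFunctional_apply, ne_eq, Prod.mk.injEq, and_true] at hne ⊢
    · have := lt_of_le_of_ne hbm hne; linarith
    · simp at hne
    · linarith
    · linarith
  · refine ⟨planeFunctional 0 1, ?_⟩
    rintro u (rfl | rfl | rfl | rfl) hne <;>
      simp only [planeFunctional_apply, ne_eq, Prod.mk.injEq, true_and] at hne ⊢
    · linarith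
    · linarith
    · simp at hne
    · have := lt_of_le_of_ne han hne; linarith
  · refine ⟨planeFunctional (-(2 * a)) (-b), ?_⟩
    rintro u (rfl | rfl | rfl | rfl) hne <;>
      simp only [planeFunctional_apply, ne_eq, Prod.mk.injEq, true_and] at hne ⊢
    · nlinarith
    · nlinarith
    · have := lt_of_le_of_ne han (Ne.symm hne); nlinarith
    · simp at hne

/-- Radial projection from the origin onto the segment joining `(c, 0)` and `(0, e)`. -/
lemma div_smul_mem_of_convex {A : Set (ℝ × ℝ)} (hA : Convex ℝ A) {c e x y : ℝ} (hc : 0 < c)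
    (he : 0 < e) (hx : 0 ≤ x) (hy : 0 ≤ y) (hs : 0 < x / c + y / e) (h1 : (c, (0 : ℝ)) ∈ A)
    (h2 : ((0 : ℝ), e) ∈ A) : (x / c + y / e)⁻¹ • (x, y) ∈ A := by
  set s := x / c + y / e
  have := hA h1 h2 (a := s⁻¹ * (x / c)) (b := s⁻¹ * (y / e)) (by positivity) (by positivity)
    (by rw [← mul_add]; exact inv_mul_cancel₀ hs.ne')
  convert! this using 1
  ext <;> simp <;> field_simp

/-- The ray from the origin through `(x, y)` meets the lower edge at a scale at most `1` and the
upper edge at a scale at least `1`, so `(x, y)` lies between two points of the hull. -/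
lemma mem_convexHull_quadrilateral (ha : 0 < a) (hb : 0 < b) (han : a ≤ n) (hbm : b ≤ m)
    {x y : ℝ} (hx : 0 ≤ x) (hy : 0 ≤ y) (hle : n * x + m * y ≤ n * m)
    (hge : a * b ≤ a * x + b * y) :
    (x, y) ∈ convexHull ℝ {(b, (0 : ℝ)), (m, (0 : ℝ)), ((0 : ℝ), n), ((0 : ℝ), a)} := by
  set A := convexHull ℝ {(b, (0 : ℝ)), (m, (0 : ℝ)), ((0 : ℝ), n), ((0 : ℝ), a)}
  have hA : Convex ℝ A := convex_convexHull ℝ _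
  have hn : 0 < n := ha.trans_le han
  have hm : 0 < m := hb.trans_le hbm
  have hτ : 1 ≤ x / b + y / a := by
    rw [div_add_div _ _ hb.ne' ha.ne', one_le_div (by positivity)]; linarith
  have hσ1 : x / m + y / n ≤ 1 := by
    rw [div_add_div _ _ hm.ne' hn.ne', div_le_one (by positivity)]; linarith
  have hσ0 : 0 < x / m + y / n := by
    rcases hx.eq_or_lt with rfl | hx'
    · have : 0 < y := by
        by_contra hy'
        have : y = 0 := le_antisymm (not_lt.1 hy') hy
        subst this
        norm_num at hτ
      positivity
    · positivity
  have h1 := div_smul_mem_of_convex hA hb ha hx hy (by linarith) (subset_convexHull ℝ _ (by simp))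
    (subset_convexHull ℝ _ (by simp))
  have h2 := div_smul_mem_of_convex hA hm hn hx hy hσ0 (subset_convexHull ℝ _ (by simp))
    (subset_convexHull ℝ _ (by simp))
  have hord := (hA.linear_preimage (LinearMap.toSpanSingleton ℝ (ℝ × ℝ) (x, y))).ordConnected
  have := hord.out h1 h2 ⟨inv_le_one_of_one_le₀ hτ, (one_le_inv₀ hσ0).2 hσ1⟩
  simpa using this

end ConvexGeometry

/-! ### The Newton polygon of a nondegenerate parameterization -/

section NewtonPolygon

open Polynomial

lemma implicitPolygonHasVertices_of_support {P Q : ℂ[X]} {φ : MvPolynomial (Fin 2) ℂ}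
    (hφ : IsImplicitEquation P Q φ) {V : Set (ℝ × ℝ)}
    (hext : (convexHull ℝ V).extremePoints ℝ = V)
    (hV : ∀ v ∈ V, ∃ d ∈ φ.support, ((d 0 : ℝ), (d 1 : ℝ)) = v)
    (hsupp : ∀ d ∈ φ.support, ((d 0 : ℝ), (d 1 : ℝ)) ∈ convexHull ℝ V) :
    ImplicitPolygonHasVertices P Q V := by
  refine ⟨⟨φ, hφ⟩, fun ψ hψ => ?_⟩
  have : newtonPolygon ψ = convexHull ℝ V := by
    rw [newtonPolygon, hψ.support_eq hφ]
    refine Set.Subset.antisymm (convexHull_min ?_ (convex_convexHull ℝ V)) (convexHull_mono ?_)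
    · rintro _ ⟨d, hd, rfl⟩
      exact hsupp d hd
    · intro v hv
      obtain ⟨d, hd, rfl⟩ := hV v hv
      exact ⟨d, hd, rfl⟩
  exact ⟨this, this ▸ hext⟩

/-- Conditions on `P = t ^ a * P'` and `Q = t ^ b * Q'` under which the Newton polygon of the
implicit resultant has vertices on the axes determined by `a`, `b` and the degrees. -/
structure IsNondegenerateParam (P Q : ℂ[X]) (a b : ℕ) : Prop where
  left_ne_zero : P ≠ 0
  right_ne_zero : Q ≠ 0
  X_pow_dvd_left : X ^ a ∣ P
  X_pow_dvd_right : X ^ b ∣ Q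
  coeff_left : (axisResultant P Q).coeff b ≠ 0
  coeff_right : (axisResultant Q P).coeff a ≠ 0

namespace IsNondegenerateParam

variable {P Q : ℂ[X]} {a b : ℕ}

lemma exists_mem_support (h : IsNondegenerateParam P Q a b) {v : ℝ × ℝ}
    (hv : v = ((b : ℝ), (0 : ℝ)) ∨ v = ((Q.natDegree : ℝ), (0 : ℝ)) ∨
      v = ((0 : ℝ), (P.natDegree : ℝ)) ∨ v = ((0 : ℝ), (a : ℝ))) :
    ∃ d ∈ (implicitResultant P Q).support, ((d 0 : ℝ), (d 1 : ℝ)) = v := by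
  simp only [MvPolynomial.mem_support_iff]
  rcases hv with rfl | rfl | rfl | rfl
  · exact ⟨_, (coeff_single_zero_implicitResultant _).2 h.coeff_left, by simp⟩
  · exact ⟨_, (coeff_single_zero_implicitResultant _).2
      (coeff_natDegree_axisResultant h.right_ne_zero), by simp⟩
  · exact ⟨_, (coeff_single_one_implicitResultant _).2
      (coeff_natDegree_axisResultant h.left_ne_zero), by simp⟩
  · exact ⟨_, (coeff_single_one_implicitResultant _).2 h.coeff_right, by simp⟩

lemma hasVertices_triangle (h : IsNondegenerateParam P Q 0 0) (hdeg : paramDegree P Q = 1) :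
    ImplicitPolygonHasVertices P Q
      {((0 : ℝ), (0 : ℝ)), ((Q.natDegree : ℝ), (0 : ℝ)), ((0 : ℝ), (P.natDegree : ℝ))} := by
  refine implicitPolygonHasVertices_of_support
    (isImplicitEquation_implicitResultant h.left_ne_zero h.right_ne_zero hdeg)
    (extremePoints_triangle (Nat.cast_nonneg _) (Nat.cast_nonneg _)) ?_ fun d hd => ?_
  · rintro v (rfl | rfl | rfl) <;> exact h.exists_mem_support (by simp)
  · have h0 := fst_le_natDegree_of_mem_support_implicitResultant hd
    have h1 := snd_le_natDegree_of_mem_support_implicitResultant hd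
    have h2 := weight_le_of_mem_support_implicitResultant hd
    refine mem_convexHull_triangle (Nat.cast_nonneg _) (Nat.cast_nonneg _) (Nat.cast_nonneg _)
      (Nat.cast_nonneg _) ?_ ?_ ?_
    · norm_cast; omega
    · norm_cast; omega
    · by_cases hn : P.natDegree = 0
      · have : (d 0 : ℝ) ≤ Q.natDegree := by exact_mod_cast h0
        simpa [hn] using div_le_one_of_le₀ this (Nat.cast_nonneg _)
      by_cases hm : Q.natDegree = 0
      · have : (d 1 : ℝ) ≤ P.natDegree := by exact_mod_cast h1
        simpa [hm] using div_le_one_of_le₀ this (Nat.cast_nonneg _)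
      have hn' : (0 : ℝ) < P.natDegree := by exact_mod_cast Nat.pos_of_ne_zero hn
      have hm' : (0 : ℝ) < Q.natDegree := by exact_mod_cast Nat.pos_of_ne_zero hm
      rw [div_add_div _ _ hm'.ne' hn'.ne', div_le_one (by positivity)]
      have : (P.natDegree * d 0 + Q.natDegree * d 1 : ℝ) ≤ P.natDegree * Q.natDegree := by
        exact_mod_cast h2
      linarith

lemma hasVertices_quadrilateral (h : IsNondegenerateParam P Q a b) (ha : a ≠ 0) (hb : b ≠ 0)
    (hdeg : paramDegree P Q = 1) :
    ImplicitPolygonHasVertices P Q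
      {((b : ℝ), (0 : ℝ)), ((Q.natDegree : ℝ), (0 : ℝ)), ((0 : ℝ), (P.natDegree : ℝ)),
        ((0 : ℝ), (a : ℝ))} := by
  have han : a ≤ P.natDegree := by
    simpa using natDegree_le_of_dvd h.X_pow_dvd_left h.left_ne_zero
  have hbm : b ≤ Q.natDegree := by
    simpa using natDegree_le_of_dvd h.X_pow_dvd_right h.right_ne_zero
  have ha' : (0 : ℝ) < a := by exact_mod_cast Nat.pos_of_ne_zero ha
  have hb' : (0 : ℝ) < b := by exact_mod_cast Nat.pos_of_ne_zero hb
  refine implicitPolygonHasVertices_of_support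
    (isImplicitEquation_implicitResultant h.left_ne_zero h.right_ne_zero hdeg)
    (extremePoints_quadrilateral ha' hb' (by exact_mod_cast han) (by exact_mod_cast hbm))
    (fun v hv => h.exists_mem_support hv) fun d hd => ?_
  refine mem_convexHull_quadrilateral ha' hb' (by exact_mod_cast han) (by exact_mod_cast hbm)
    (Nat.cast_nonneg _) (Nat.cast_nonneg _) ?_ ?_
  · exact_mod_cast weight_le_of_mem_support_implicitResultant hd
  · exact_mod_cast le_weight_of_mem_support_implicitResultant han hbm h.X_pow_dvd_left
      h.X_pow_dvd_right hd

end IsNondegenerateParam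

end NewtonPolygon

/-! ### Generic coefficients are nondegenerate -/

section Generic

open Polynomial

/-- The polynomial with exponents in `S`, shifted down by `a`, and coefficient vector `c`. -/
noncomputable def shiftedPolyOf {R : Type*} [CommRing R] (S : Finset ℕ) (a : ℕ) (c : S → R) :
    R[X] :=
  ∑ k : S, monomial (k - a : ℕ) (c k)

lemma X_pow_mul_shiftedPolyOf {S : Finset ℕ} {a : ℕ} (ha : ∀ k ∈ S, a ≤ k) (c : S → ℂ) :
    X ^ a * shiftedPolyOf S a c = polyOf S c := by
  rw [shiftedPolyOf, polyOf, Finset.mul_sum]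
  refine Finset.sum_congr rfl fun k _ => ?_
  rw [X_pow_mul_monomial, Nat.sub_add_cancel (ha k k.2)]

lemma map_shiftedPolyOf {R T : Type*} [CommRing R] [CommRing T] (f : R →+* T) (S : Finset ℕ)
    (a : ℕ) (c : S → R) :
    (shiftedPolyOf S a c).map f = shiftedPolyOf S a fun k => f (c k) := by
  simp [shiftedPolyOf, Polynomial.map_sum]

lemma shiftedPolyOf_ite {R : Type*} [CommRing R] (S : Finset ℕ) (a : ℕ) (i : S) :
    shiftedPolyOf S a (fun k => if k = i then (1 : R) else 0) = X ^ (i - a : ℕ) := by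
  rw [shiftedPolyOf, Finset.sum_eq_single i]
  · simp [monomial_one_right_eq_X_pow]
  · intro k _ hk
    simp [hk]
  · simp

lemma coeff_polyOf (S : Finset ℕ) (c : S → ℂ) (i : S) : (polyOf S c).coeff i = c i := by
  rw [polyOf, finsetSum_coeff, Finset.sum_eq_single i]
  · simp
  · intro k _ hk
    rw [coeff_monomial, if_neg fun h => hk (Subtype.ext h)]
  · simp

lemma natDegree_polyOf {S : Finset ℕ} (hS : S.Nonempty) {c : S → ℂ} (hc : ∀ i, c i ≠ 0) :
    (polyOf S c).natDegree = S.max' hS := by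
  refine le_antisymm ?_ (le_natDegree_of_ne_zero ?_)
  · exact natDegree_sum_le_of_forall_le _ _ fun k _ =>
      (natDegree_monomial_le _).trans (S.le_max' k k.2)
  · exact (coeff_polyOf S c ⟨_, S.max'_mem hS⟩).trans_ne (hc _)

lemma polyOf_ne_zero {S : Finset ℕ} (hS : S.Nonempty) {c : S → ℂ} (hc : ∀ i, c i ≠ 0) :
    polyOf S c ≠ 0 := fun h => by
  have := coeff_polyOf S c ⟨_, S.max'_mem hS⟩
  rw [h, coeff_zero] at this
  exact hc _ this.symm

lemma coeff_zero_shiftedPolyOf {S : Finset ℕ} {a : ℕ} (ha : ∀ k ∈ S, a ≤ k) (haS : a ∈ S)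
    (c : S → ℂ) : (shiftedPolyOf S a c).coeff 0 = c ⟨a, haS⟩ := by
  have := coeff_polyOf S c ⟨a, haS⟩
  rwa [← X_pow_mul_shiftedPolyOf ha, coeff_X_pow_mul', if_pos le_rfl, Nat.sub_self] at this

variable {S₀ S₁ : Finset ℕ} (h₀ : S₀.Nonempty) (h₁ : S₁.Nonempty) {a b : ℕ}

/-- The resultant of the shifted polynomials with indeterminate coefficients. -/
noncomputable def shiftedResultant (a b : ℕ) : MvPolynomial (S₀ ⊕ S₁) ℂ :=
  resultant (shiftedPolyOf S₀ a fun k => MvPolynomial.X (Sum.inl k))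
    (shiftedPolyOf S₁ b fun k => MvPolynomial.X (Sum.inr k)) (S₀.max' h₀ - a) (S₁.max' h₁ - b)

lemma eval_shiftedResultant (c : S₀ ⊕ S₁ → ℂ) :
    MvPolynomial.eval c (shiftedResultant h₀ h₁ a b) =
      resultant (shiftedPolyOf S₀ a fun k => c (Sum.inl k))
        (shiftedPolyOf S₁ b fun k => c (Sum.inr k)) (S₀.max' h₀ - a) (S₁.max' h₁ - b) := by
  rw [shiftedResultant, ← resultant_map_map, map_shiftedPolyOf, map_shiftedPolyOf]
  congr 2 <;> funext k <;> exact MvPolynomial.eval_X _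

/-- One specialization suffices: make one shifted polynomial `1` and the other the power of `t` of
full formal degree. -/
lemma shiftedResultant_ne_zero (h : a ∈ S₀ ∨ b ∈ S₁) : shiftedResultant h₀ h₁ a b ≠ 0 := by
  classical
  intro hzero
  rcases h with h | h
  · have := eval_shiftedResultant h₀ h₁ (a := a) (b := b)
      (Sum.elim (fun k => if k = ⟨a, h⟩ then 1 else 0)
        (fun k => if k = ⟨_, S₁.max'_mem h₁⟩ then 1 else 0))
    simp only [Sum.elim_inl, Sum.elim_inr] at this
    rw [hzero, shiftedPolyOf_ite, shiftedPolyOf_ite, Nat.sub_self, pow_zero] at this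
    rw [map_zero, resultant_one_left] at this
    simp only [coeff_X_pow, if_true, one_pow, mul_one] at this
    exact pow_ne_zero _ (by simp) this.symm
  · have := eval_shiftedResultant h₀ h₁ (a := a) (b := b)
      (Sum.elim (fun k => if k = ⟨_, S₀.max'_mem h₀⟩ then 1 else 0)
        (fun k => if k = ⟨b, h⟩ then 1 else 0))
    simp only [Sum.elim_inl, Sum.elim_inr] at this
    rw [hzero, shiftedPolyOf_ite, shiftedPolyOf_ite, Nat.sub_self, pow_zero] at this
    rw [map_zero, resultant_one_right] at this
    simp at this

lemma holdsGenerically_isNondegenerateParam (ha : ∀ k ∈ S₀, a ≤ k) (hb : ∀ k ∈ S₁, b ≤ k)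
    (hab : a ∈ S₀ ∨ b ∈ S₁) (ha' : a ≠ 0 → b ≠ 0 ∧ b ∈ S₁) (hb' : b ≠ 0 → a ≠ 0 ∧ a ∈ S₀) :
    HoldsGenerically fun c : S₀ ⊕ S₁ → ℂ =>
      (polyOf S₀ fun k => c (Sum.inl k)).natDegree = S₀.max' h₀ ∧
      (polyOf S₁ fun k => c (Sum.inr k)).natDegree = S₁.max' h₁ ∧
      IsNondegenerateParam (polyOf S₀ fun k => c (Sum.inl k)) (polyOf S₁ fun k => c (Sum.inr k))
        a b := by
  -- Nonzero coefficients fix the degrees and the needed lowest terms; the resultant excludes common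
  -- roots of the shifted polynomials.
  refine ⟨(∏ i, MvPolynomial.X i) * shiftedResultant h₀ h₁ a b,
    mul_ne_zero (Finset.prod_ne_zero_iff.2 fun i _ => MvPolynomial.X_ne_zero i)
      (shiftedResultant_ne_zero h₀ h₁ hab), fun c hc => ?_⟩
  rw [map_mul, map_prod, eval_shiftedResultant] at hc
  have hc0 : ∀ i, c i ≠ 0 := fun i => by
    simpa using Finset.prod_ne_zero_iff.1 (left_ne_zero_of_mul hc) i (Finset.mem_univ i)
  have hres := right_ne_zero_of_mul hc
  have hP := polyOf_ne_zero h₀ fun i => hc0 (Sum.inl i)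
  have hQ := polyOf_ne_zero h₁ fun i => hc0 (Sum.inr i)
  have hPd := natDegree_polyOf h₀ fun i => hc0 (Sum.inl i)
  have hQd := natDegree_polyOf h₁ fun i => hc0 (Sum.inr i)
  refine ⟨hPd, hQd, ?_⟩
  have hP0 := fun h => coeff_zero_shiftedPolyOf ha h fun k => c (Sum.inl k)
  have hQ0 := fun h => coeff_zero_shiftedPolyOf hb h fun k => c (Sum.inr k)
  rw [← X_pow_mul_shiftedPolyOf ha] at hP hPd ⊢
  rw [← X_pow_mul_shiftedPolyOf hb] at hQ hQd ⊢
  set P' := shiftedPolyOf S₀ a fun k => c (Sum.inl k)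
  set Q' := shiftedPolyOf S₁ b fun k => c (Sum.inr k)
  have hP' : P' ≠ 0 := right_ne_zero_of_mul hP
  have hQ' : Q' ≠ 0 := right_ne_zero_of_mul hQ
  rw [natDegree_mul (by simp) hP', natDegree_X_pow] at hPd
  rw [natDegree_mul (by simp) hQ', natDegree_X_pow] at hQd
  rw [← hPd, ← hQd, Nat.add_sub_cancel_left, Nat.add_sub_cancel_left] at hres
  have hres' : resultant Q' P' ≠ 0 := by
    rw [resultant_comm]
    exact mul_ne_zero (by simp) hres
  refine ⟨hP, hQ, dvd_mul_right _ _, dvd_mul_right _ _,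
    coeff_axisResultant_X_pow_mul hP' hQ' hres (fun h => (hb' h).1) (fun h => ?_),
    coeff_axisResultant_X_pow_mul hQ' hP' hres' (fun h => (ha' h).1) (fun h => ?_)⟩
  · rw [hQ0 (ha' h).2]
    exact hc0 _
  · rw [hP0 (hb' h).2]
    exact hc0 _

lemma HoldsGenerically.mono {ι : Type} {p q : (ι → ℂ) → Prop} (hp : HoldsGenerically p)
    (h : ∀ c, p c → q c) : HoldsGenerically q :=
  let ⟨F, hF, hFp⟩ := hp
  ⟨F, hF, fun c hc => h c (hFp c hc)⟩

end Generic

theorem theoremT (S₀ S₁ : Finset ℕ) (h₀ : S₀.Nonempty) (h₁ : S₁.Nonempty) :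
    ((0 ∈ S₀ ∨ 0 ∈ S₁) →
      HoldsGenerically fun c : S₀ ⊕ S₁ → ℂ =>
        paramDegree (polyOf S₀ fun k => c (Sum.inl k)) (polyOf S₁ fun k => c (Sum.inr k)) = 1 →
          ImplicitPolygonHasVertices
            (polyOf S₀ fun k => c (Sum.inl k)) (polyOf S₁ fun k => c (Sum.inr k))
            {((0 : ℝ), (0 : ℝ)), ((S₁.max' h₁ : ℝ), (0 : ℝ)), ((0 : ℝ), (S₀.max' h₀ : ℝ))}) ∧
    (0 ∉ S₀ → 0 ∉ S₁ →
      HoldsGenerically fun c : S₀ ⊕ S₁ → ℂ =>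
        paramDegree (polyOf S₀ fun k => c (Sum.inl k)) (polyOf S₁ fun k => c (Sum.inr k)) = 1 →
          ImplicitPolygonHasVertices
            (polyOf S₀ fun k => c (Sum.inl k)) (polyOf S₁ fun k => c (Sum.inr k))
            {((S₁.min' h₁ : ℝ), (0 : ℝ)), ((S₁.max' h₁ : ℝ), (0 : ℝ)),
              ((0 : ℝ), (S₀.max' h₀ : ℝ)), ((0 : ℝ), (S₀.min' h₀ : ℝ))}) := by
  constructor
  · intro h
    -- No power of `t` is removed, even if one support misses `0`: it suffices that `P` and `Q` have
    -- no common root, so that the curve avoids the origin and `R(0, 0) ≠ 0`.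
    refine (holdsGenerically_isNondegenerateParam h₀ h₁ (a := 0) (b := 0) (by simp) (by simp) h
      (by simp) (by simp)).mono ?_
    rintro c ⟨hP, hQ, hc⟩ hdeg
    rw [← hP, ← hQ]
    exact hc.hasVertices_triangle hdeg
  · intro hn₀ hn₁
    have hmin₀ : S₀.min' h₀ ≠ 0 := fun h => hn₀ (h ▸ S₀.min'_mem h₀)
    have hmin₁ : S₁.min' h₁ ≠ 0 := fun h => hn₁ (h ▸ S₁.min'_mem h₁)
    refine (holdsGenerically_isNondegenerateParam h₀ h₁ (S₀.min'_le · ·) (S₁.min'_le · ·)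
      (.inl (S₀.min'_mem h₀)) (fun _ => ⟨hmin₁, S₁.min'_mem h₁⟩)
      (fun _ => ⟨hmin₀, S₀.min'_mem h₀⟩)).mono ?_
    rintro c ⟨hP, hQ, hc⟩ hdeg
    rw [← hP, ← hQ]
    exact hc.hasVertices_quadrilateral hmin₀ hmin₁ hdeg
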